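/- Let $M$ be a matroid with finite ground set $E(M)$ and rank function $r$. A set system $(A_1,\dots,A_k)$ of subsets of $E(M)$ (repetitions allowed) is a presentation of $M$ if the independent sets of $M$ are exactly its partial transversals, i.e. the sets $I\subseteq E(M)$ for which there is an injection $\phi:I\to\{1,\dots,k\}$ with $x\in A_{\phi(x)}$ for all $x\in I$. The matroid $M$ is a fundamental transversal matroid if it has a presentation $(A_1,\dots,A_k)$ such that $A_i\setminus\bigcup_{j\neq i}A_j\neq\emptyset$ for every $i\in\{1,\dots,k\}$. A cyclic flat of $M$ is a flat that is a (possibly empty) union of circuits; let $\mathcal{Z}(M)$ be the set of cyclic flats, ordered by inclusion. A filter in $\mathcal{Z}(M)$ is a set $\mathcal{F}\subseteq\mathcal{Z}(M)$ such that $X\in\mathcal{F}$, $Y\in\mathcal{Z}(M)$ and $X\subseteq Y$ imply $Y\in\mathcal{F}$; an antichain is a set $\mathcal{F}\subseteq\mathcal{Z}(M)$ no two distinct members of which are related by inclusion. For a nonempty set $\mathcal{F}\subseteq\mathcal{Z}(M)$ consider the equality $$r\Bigl(\bigcap_{X\in\mathcal{F}}X\Bigr)=\sum_{\mathcal{F}'\subseteq\mathcal{F}}(-1)^{|\mathcal{F}'|+1}\,r\Bigl(\bigcup_{X\in\mathcal{F}'}X\Bigr).\qquad(*)$$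 Theorem. The following statements are equivalent: 1. $M$ is a fundamental transversal matroid; 2. $(*)$ holds for all nonempty subsets $\mathcal{F}$ of $\mathcal{Z}(M)$; 3. $(*)$ holds for all nonempty antichains $\mathcal{F}$ in $\mathcal{Z}(M)$; 4. $(*)$ holds for all nonempty filters $\mathcal{F}$ in $\mathcal{Z}(M)$. -/

import Mathlib

/-- The family `A` of subsets of the ground set is a presentation of `M`: the independent sets of
`M` are exactly the partial transversals of `A`. Indexing by `Fin r` allows repeated and empty
sets. -/
def Matroid.IsPresentation {α : Type*} (M : Matroid α) {r : ℕ} (A : Fin r → Set α) : Prop :=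
  (∀ i, A i ⊆ M.E) ∧
    ∀ I : Set α, M.Indep I ↔
      ∃ φ : I → Fin r, Function.Injective φ ∧ ∀ x : I, (x : α) ∈ A (φ x)

/-- A fundamental transversal matroid: some presentation has the property that each of its sets
contains an element that lies in no other set of the presentation. -/
def Matroid.IsFundamentalTransversal {α : Type*} (M : Matroid α) : Prop :=
  ∃ (r : ℕ) (A : Fin r → Set α), M.IsPresentation A ∧
    ∀ i, (A i \ ⋃ (j : Fin r) (_ : j ≠ i), A j).Nonempty

/-- A cyclic set: a (possibly empty) union of circuits. -/
def Matroid.IsCyclicSet {α : Type*} (M : Matroid α) (X : Set α) : Prop :=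
  ∃ 𝒞 : Set (Set α), (∀ C ∈ 𝒞, M.IsCircuit C) ∧ X = ⋃₀ 𝒞

/-- The set of cyclic flats of `M`. -/
def Matroid.cyclicFlats {α : Type*} (M : Matroid α) : Set (Set α) :=
  {F | M.IsFlat F ∧ M.IsCyclicSet F}

/-- The rank of a set as an integer. The conversion from `ℕ∞` loses nothing when `M` has finite
rank, in particular when its ground set is finite. -/
noncomputable def Matroid.intRk {α : Type*} (M : Matroid α) (X : Set α) : ℤ :=
  ((M.eRk X).toNat : ℤ)

/-- The equality case of Mason's inequality for the family `ℱ`: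
`r(⋂ ℱ) = ∑_{𝒢 ⊆ ℱ} (-1)^(|𝒢|+1) r(⋃ 𝒢)`. -/
def Matroid.MasonEquality {α : Type*} (M : Matroid α) (ℱ : Finset (Set α)) : Prop :=
  M.intRk (⋂₀ (ℱ : Set (Set α))) =
    ∑ 𝒢 ∈ ℱ.powerset, (-1 : ℤ) ^ (𝒢.card + 1) * M.intRk (⋃₀ (𝒢 : Set (Set α)))

namespace Matroid

open Set

/-! ### Integer-valued rank on a finite ground set. -/

section Rank

variable {α : Type*} {M : Matroid α}

/-! Everything rests on a base `B` that contains a basis of every cyclic flat. For such a base,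
ranks of unions and intersections of cyclic flats just count elements of `B`, so (*) is
inclusion-exclusion.

A fundamental presentation supplies such elements: one private element `b i` for each set `A i`. A
cyclic flat meeting `A i` must contain `b i` (`IsPresentation.mem_cyclicFlat`), which gives (*) for
all families. Antichains suffice for (*), since the larger of two comparable members can be dropped
(`MasonEquality.of_erase`).

For the converse, Möbius inversion on the cyclic flats gives weights `β` with `r(X) = ∑ β Y` over
all `Y` not containing `X` (`exists_weight`). For `Y` other than the top cyclic flat, let `W Y` be
the intersection of all cyclic flats not below `Y`. Comparing (*) for the filter of these flats and
for that filter with `Y` added gives `β Y = r(W Y) - r(W Y ∩ Y)`, so `0 ≤ β Y ≤ |W Y \ Y|`. Choose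
`β Y` elements of each `W Y \ Y`. A circuit among the chosen elements would exceed the rank of its
closure, so they are independent. Any base extending them is the desired `B`, and its fundamental
cocircuits form a presentation (`IsBase.isFundamentalTransversal`). -/

lemma intRk_eq_ncard_of_isBasis' {I X : Set α} (hI : M.IsBasis' I X) :
    M.intRk X = I.ncard := by
  rw [intRk, hI.eRk_eq_encard, ncard_def]

@[simp]
lemma intRk_closure (M : Matroid α) (X : Set α) : M.intRk (M.closure X) = M.intRk X := by
  rw [intRk, eRk_closure_eq, intRk]

@[simp]
lemma intRk_empty (M : Matroid α) : M.intRk ∅ = 0 := by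
  simp [intRk]

lemma eRk_ne_top_of_ground_finite (hM : M.E.Finite) (X : Set α) : M.eRk X ≠ ⊤ := by
  have h := (M.eRk_le_eRank X).trans M.eRank_le_encard_ground
  exact (h.trans_lt hM.encard_lt_top).ne

lemma Indep.ncard_le_intRk (hM : M.E.Finite) {I X : Set α} (hI : M.Indep I) (hIX : I ⊆ X) :
    (I.ncard : ℤ) ≤ M.intRk X := by
  rw [intRk, ncard_def]
  exact_mod_cast ENat.toNat_le_toNat (hI.encard_le_eRk_of_subset hIX)
    (eRk_ne_top_of_ground_finite hM X)

lemma intRk_le_intRk_inter_add_ncard_sdiff (hM : M.E.Finite) {X : Set α} (hX : X ⊆ M.E)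
    (Y : Set α) : M.intRk X ≤ M.intRk (X ∩ Y) + (X \ Y).ncard := by
  have hfin : (X \ Y).encard ≠ ⊤ := ((hM.subset hX).sdiff).encard_lt_top.ne
  have h := (M.eRk_le_eRk_inter_add_eRk_sdiff X Y).trans
    (add_le_add_right (M.eRk_le_encard (X \ Y)) _)
  have h2 := ENat.toNat_le_toNat h
    (WithTop.add_ne_top.2 ⟨eRk_ne_top_of_ground_finite hM _, hfin⟩)
  rw [ENat.toNat_add (eRk_ne_top_of_ground_finite hM _) hfin] at h2
  rw [intRk, intRk, ncard_def]
  exact_mod_cast h2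

lemma Indep.isBasis_of_intRk_le_ncard (hM : M.E.Finite) {I X : Set α} (hI : M.Indep I)
    (hIX : I ⊆ X) (hX : X ⊆ M.E) (h : M.intRk X ≤ I.ncard) : M.IsBasis I X := by
  obtain ⟨J, hJ, hIJ⟩ := hI.subset_isBasis_of_subset hIX
  rw [intRk_eq_ncard_of_isBasis' hJ.isBasis'] at h
  rwa [eq_of_subset_of_ncard_le hIJ (by exact_mod_cast h) (hM.subset hJ.indep.subset_ground)]

lemma IsCircuit.ncard_eq_intRk_add_one (hM : M.E.Finite) {C : Set α} (hC : M.IsCircuit C) :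
    (C.ncard : ℤ) = M.intRk C + 1 := by
  obtain ⟨e, he⟩ := hC.nonempty
  rw [intRk_eq_ncard_of_isBasis' (hC.sdiff_singleton_isBasis he).isBasis']
  exact_mod_cast (ncard_sdiff_singleton_add_one he (hM.subset hC.subset_ground)).symm

end Rank

/-! ### Cyclic sets and cyclic flats. -/

section CyclicFlats

variable {α : Type*} {M : Matroid α}

lemma isCyclicSet_iff {X : Set α} :
    M.IsCyclicSet X ↔ ∀ x ∈ X, ∃ C, M.IsCircuit C ∧ C ⊆ X ∧ x ∈ C := by
  constructor
  · rintro ⟨𝒞, h𝒞, rfl⟩ x ⟨C, hC, hx⟩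
    exact ⟨C, h𝒞 C hC, subset_sUnion_of_mem hC, hx⟩
  · refine fun h ↦ ⟨{C | M.IsCircuit C ∧ C ⊆ X}, fun C hC ↦ hC.1, ?_⟩
    refine Subset.antisymm (fun x hx ↦ ?_) (sUnion_subset fun C hC ↦ hC.2)
    obtain ⟨C, hC, hCX, hxC⟩ := h x hx
    exact ⟨C, ⟨hC, hCX⟩, hxC⟩

lemma IsCyclicSet.subset_ground {X : Set α} (hX : M.IsCyclicSet X) : X ⊆ M.E := by
  obtain ⟨𝒞, h𝒞, rfl⟩ := hX
  exact sUnion_subset fun C hC ↦ (h𝒞 C hC).subset_ground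

lemma IsCyclicSet.closure_mem_cyclicFlats {X : Set α} (hX : M.IsCyclicSet X) :
    M.closure X ∈ M.cyclicFlats := by
  refine ⟨M.isFlat_closure X, isCyclicSet_iff.2 fun x hx ↦ ?_⟩
  have hcl := M.subset_closure X hX.subset_ground
  by_cases hxX : x ∈ X
  · obtain ⟨C, hC, hCX, hxC⟩ := isCyclicSet_iff.1 hX x hxX
    exact ⟨C, hC, hCX.trans hcl, hxC⟩
  · obtain ⟨C, hCX, hC, hxC⟩ := exists_isCircuit_of_mem_closure hx hxX
    exact ⟨C, hC, hCX.trans (insert_subset hx hcl), hxC⟩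

lemma isCyclicSet_sUnion {𝒢 : Set (Set α)} (h𝒢 : 𝒢 ⊆ M.cyclicFlats) :
    M.IsCyclicSet (⋃₀ 𝒢) := by
  refine isCyclicSet_iff.2 fun x ⟨X, hX, hx⟩ ↦ ?_
  obtain ⟨C, hC, hCX, hxC⟩ := isCyclicSet_iff.1 (h𝒢 hX).2 x hx
  exact ⟨C, hC, hCX.trans (subset_sUnion_of_mem hX), hxC⟩

lemma cyclicFlats_finite (hM : M.E.Finite) : M.cyclicFlats.Finite :=
  hM.finite_subsets.subset fun _ hX ↦ hX.1.subset_ground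

end CyclicFlats

/-! ### Reduction of the Mason equality to antichains. -/

section Mason

variable {α : Type*} {M : Matroid α}

/-- Since `X ⊆ Y`, dropping `Y` leaves the intersection unchanged. The subfamilies containing `Y`
pair off by whether they contain `X`: paired unions agree and the signs are opposite. -/
lemma MasonEquality.of_erase [DecidableEq (Set α)] {ℱ : Finset (Set α)} {X Y : Set α}
    (hX : X ∈ ℱ) (hY : Y ∈ ℱ) (hne : X ≠ Y) (hXY : X ⊆ Y) (h : M.MasonEquality (ℱ.erase Y)) :
    M.MasonEquality ℱ := by
  set 𝒢 := (ℱ.erase Y).erase X with h𝒢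
  have hX' : X ∈ ℱ.erase Y := Finset.mem_erase.2 ⟨hne, hX⟩
  have h1 : ℱ.erase Y = insert X 𝒢 := (Finset.insert_erase hX').symm
  have h2 : ℱ = insert Y (insert X 𝒢) := by rw [← h1, Finset.insert_erase hY]
  have hX𝒢 : X ∉ 𝒢 := Finset.notMem_erase _ _
  have hYX : Y ∉ insert X 𝒢 := by rw [← h1]; exact Finset.notMem_erase _ _
  have hinter : ⋂₀ (ℱ : Set (Set α)) = ⋂₀ ((ℱ.erase Y : Finset (Set α)) : Set (Set α)) := by
    rw [h2, Finset.erase_insert hYX, Finset.coe_insert, sInter_insert]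
    exact inter_eq_right.2 ((sInter_subset_of_mem (by simp)).trans hXY)
  rw [MasonEquality] at h ⊢
  rw [hinter, h, h1]
  conv_rhs => rw [h2, Finset.sum_powerset_insert hYX]
  rw [left_eq_add, Finset.sum_powerset_insert hX𝒢, ← Finset.sum_add_distrib]
  refine Finset.sum_eq_zero fun 𝒯 h𝒯 ↦ ?_
  have h𝒯' := Finset.mem_powerset.1 h𝒯
  have hX𝒯 : X ∉ 𝒯 := fun hX ↦ hX𝒢 (h𝒯' hX)
  have hY𝒯 : Y ∉ insert X 𝒯 := fun hY ↦ hYX (Finset.insert_subset_insert _ h𝒯' hY)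
  have hY𝒯' : Y ∉ 𝒯 := fun hY ↦ hY𝒯 (Finset.mem_insert_of_mem hY)
  rw [Finset.card_insert_of_notMem hY𝒯, Finset.card_insert_of_notMem hX𝒯,
    Finset.card_insert_of_notMem hY𝒯']
  simp only [Finset.coe_insert, sUnion_insert]
  rw [← union_assoc, union_eq_self_of_subset_right hXY]
  ring

lemma masonEquality_of_forall_isAntichain
    (h : ∀ ℱ : Finset (Set α), ℱ.Nonempty → (ℱ : Set (Set α)) ⊆ M.cyclicFlats →
      IsAntichain (· ⊆ ·) (ℱ : Set (Set α)) → M.MasonEquality ℱ)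
    (ℱ : Finset (Set α)) (hne : ℱ.Nonempty) (hℱ : (ℱ : Set (Set α)) ⊆ M.cyclicFlats) :
    M.MasonEquality ℱ := by
  classical
  induction ℱ using Finset.strongInduction with
  | H ℱ ih =>
    by_cases hanti : IsAntichain (· ⊆ ·) (ℱ : Set (Set α))
    · exact h ℱ hne hℱ hanti
    · obtain ⟨X, hX, Y, hY, hXY, hsub⟩ : ∃ X ∈ ℱ, ∃ Y ∈ ℱ, X ≠ Y ∧ X ⊆ Y := by
        by_contra! hno
        exact hanti fun X hX Y hY hXY ↦ hno X hX Y hY hXY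
      refine MasonEquality.of_erase hX hY hXY hsub (ih _ (Finset.erase_ssubset hY) ?_ ?_)
      · exact ⟨X, Finset.mem_erase.2 ⟨hXY, hX⟩⟩
      · exact (Finset.coe_subset.2 (Finset.erase_subset _ _)).trans hℱ

end Mason

/-! ### Fundamental presentations imply the Mason equality. -/

section Presentation

variable {α : Type*} {M : Matroid α} {r : ℕ} {A : Fin r → Set α}

open scoped Classical in
/-- The indices of the members of a family of sets that meet a given set. -/
noncomputable def meetingIndices (A : Fin r → Set α) (X : Set α) : Finset (Fin r) :=
  {i | (A i ∩ X).Nonempty}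

lemma mem_meetingIndices {X : Set α} {i : Fin r} :
    i ∈ meetingIndices A X ↔ (A i ∩ X).Nonempty := by
  simp [meetingIndices]

lemma ncard_le_card_of_transversal {I : Set α} (φ : I → Fin r) (hφ : φ.Injective)
    (N : Finset (Fin r)) (hN : ∀ x, φ x ∈ N) : I.ncard ≤ N.card := by
  have h : Nat.card I ≤ Nat.card N :=
    Nat.card_le_card_of_injective (fun x ↦ (⟨φ x, hN x⟩ : N))
      fun x y hxy ↦ hφ (congrArg Subtype.val hxy)
  rwa [Nat.card_coe_set_eq, Nat.card_eq_fintype_card, Fintype.card_coe] at h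

lemma exists_transversal_of_forall_subset {I : Set α}
    (h : ∀ S ⊆ I, S.Finite → S.ncard ≤ (meetingIndices A S).card) :
    ∃ φ : I → Fin r, Function.Injective φ ∧ ∀ x : I, (x : α) ∈ A (φ x) := by
  classical
  obtain ⟨φ, hφ, hφA⟩ := (Finset.all_card_le_biUnion_card_iff_exists_injective
    (fun x : I ↦ meetingIndices A {(x : α)})).1 fun s ↦ by
      have hs := h (Subtype.val '' (s : Set I)) (by simp) (s.finite_toSet.image _)
      rw [ncard_image_of_injective _ Subtype.val_injective, ncard_coe_finset] at hs
      refine hs.trans (Finset.card_le_card fun i hi ↦ ?_)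
      obtain ⟨_, hx, x, hxs, rfl⟩ := mem_meetingIndices.1 hi
      exact Finset.mem_biUnion.2 ⟨x, hxs, mem_meetingIndices.2 ⟨x, hx, rfl⟩⟩
  refine ⟨φ, hφ, fun x ↦ ?_⟩
  obtain ⟨y, hy, hyx⟩ := mem_meetingIndices.1 (hφA x)
  rwa [mem_singleton_iff.1 hyx] at hy

lemma IsPresentation.ncard_le_card_meetingIndices (hA : M.IsPresentation A) {I X : Set α}
    (hI : M.Indep I) (hIX : I ⊆ X) : I.ncard ≤ (meetingIndices A X).card := by
  obtain ⟨φ, hφ, hφA⟩ := (hA.2 I).1 hI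
  exact ncard_le_card_of_transversal φ hφ _
    fun x ↦ mem_meetingIndices.2 ⟨x, hφA x, hIX x.2⟩

/-- Proper subsets of a circuit are independent and so satisfy Hall's condition. The condition must
therefore fail at the circuit itself. -/
lemma IsPresentation.card_meetingIndices_lt_ncard (hA : M.IsPresentation A) {C : Set α}
    (hC : M.IsCircuit C) : (meetingIndices A C).card < C.ncard := by
  by_contra! hle
  refine hC.not_indep ((hA.2 C).2 (exists_transversal_of_forall_subset fun S hS _ ↦ ?_))
  obtain rfl | hSC := eq_or_ssubset_of_subset hS
  · exact hle
  · exact hA.ncard_le_card_meetingIndices (hC.ssubset_indep hSC) Subset.rfl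

/-- Otherwise exchanging `e ∈ C` for `b` gives an independent set of size `|C|`. Its transversal can
match `b` only to `i`, so it uses only indices meeting `C`, and there are fewer than `|C|` of these.
-/
lemma IsPresentation.mem_closure_isCircuit (hM : M.E.Finite) (hA : M.IsPresentation A)
    {C : Set α} (hC : M.IsCircuit C) {i : Fin r} (hi : (A i ∩ C).Nonempty) {b : α}
    (hb : b ∈ A i) (hbA : ∀ j, b ∈ A j → j = i) : b ∈ M.closure C := by
  obtain ⟨e, he⟩ := hC.nonempty
  have hI := hC.sdiff_singleton_indep he
  have hbE := hA.1 i hb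
  by_contra hbC
  have hbI : b ∉ M.closure (C \ {e}) := by rwa [hC.closure_sdiff_singleton_eq]
  have hbI' : b ∉ C \ {e} := fun h ↦ hbI (M.mem_closure_of_mem h hI.subset_ground)
  have hins : M.Indep (insert b (C \ {e})) :=
    (hI.insert_indep_iff_of_notMem hbI').2 ⟨hbE, hbI⟩
  obtain ⟨φ, hφ, hφA⟩ := (hA.2 _).1 hins
  have hle := ncard_le_card_of_transversal φ hφ (meetingIndices A C) fun x ↦ by
    rw [mem_meetingIndices]
    obtain hx | hx := mem_insert_iff.1 x.2
    · have hbx := hφA x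
      rw [hx] at hbx
      rwa [hbA _ hbx]
    · exact ⟨x, hφA x, hx.1⟩
  have hCfin := hM.subset hC.subset_ground
  rw [ncard_insert_of_notMem hbI' (hCfin.sdiff), ncard_sdiff_singleton_add_one he hCfin] at hle
  exact (hA.card_meetingIndices_lt_ncard hC).not_ge hle

lemma IsPresentation.mem_cyclicFlat (hM : M.E.Finite) (hA : M.IsPresentation A)
    {F : Set α} (hF : F ∈ M.cyclicFlats) {i : Fin r} (hi : (A i ∩ F).Nonempty) {b : α}
    (hb : b ∈ A i) (hbA : ∀ j, b ∈ A j → j = i) : b ∈ F := by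
  obtain ⟨x, hxi, hxF⟩ := hi
  obtain ⟨C, hC, hCF, hxC⟩ := isCyclicSet_iff.1 hF.2 x hxF
  rw [← hF.1.closure]
  exact M.closure_subset_closure hCF (hA.mem_closure_isCircuit hM hC ⟨x, hxi, hxC⟩ hb hbA)

-- The hypothesis on `X` makes the indices meeting `X` exactly those with `b i ∈ X`. Their number
-- bounds the rank from above, and the private elements in `X` form an independent set attaining it.
open scoped Classical in
lemma IsPresentation.intRk_eq_card (hM : M.E.Finite) (hA : M.IsPresentation A) {b : Fin r → α}
    (hb : ∀ i, b i ∈ A i) (hbA : ∀ i j, b i ∈ A j → j = i) {X : Set α}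
    (hX : ∀ i, (A i ∩ X).Nonempty → b i ∈ X) :
    M.intRk X = (Finset.univ.filter fun i ↦ b i ∈ X).card := by
  have hmeet : meetingIndices A X = Finset.univ.filter fun i ↦ b i ∈ X := by
    ext i
    simp only [mem_meetingIndices, Finset.mem_filter, Finset.mem_univ, true_and]
    exact ⟨hX i, fun h ↦ ⟨b i, hb i, h⟩⟩
  have hinj : Function.Injective b := fun i j hij ↦ hbA j i (hij ▸ hb i)
  refine le_antisymm ?_ ?_
  · obtain ⟨I, hI⟩ := M.exists_isBasis' X
    rw [intRk_eq_ncard_of_isBasis' hI, ← hmeet]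
    exact_mod_cast hA.ncard_le_card_meetingIndices hI.indep hI.subset
  · have hind : M.Indep (b '' {i | b i ∈ X}) := by
      have hex : ∀ x : ↥(b '' {i | b i ∈ X}), ∃ i, b i = x := by
        rintro ⟨_, i, -, rfl⟩
        exact ⟨i, rfl⟩
      choose φ hφ using hex
      refine (hA.2 _).2 ⟨φ, fun x y hxy ↦ Subtype.ext (by rw [← hφ, ← hφ, hxy]), fun x ↦ ?_⟩
      have hx := hb (φ x)
      rwa [hφ] at hx
    have hle := hind.ncard_le_intRk hM (X := X) (by rintro _ ⟨i, hi, rfl⟩; exact hi)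
    rw [ncard_image_of_injective _ hinj] at hle
    rwa [show {i | b i ∈ X} = ((Finset.univ.filter fun i ↦ b i ∈ X : Finset (Fin r)) :
      Set (Fin r)) by ext; simp, ncard_coe_finset] at hle

lemma IsFundamentalTransversal.masonEquality (hM : M.E.Finite)
    (h : M.IsFundamentalTransversal) (ℱ : Finset (Set α)) (hne : ℱ.Nonempty)
    (hℱ : (ℱ : Set (Set α)) ⊆ M.cyclicFlats) : M.MasonEquality ℱ := by
  classical
  obtain ⟨r, A, hA, hpriv⟩ := h
  choose b hb using hpriv
  have hbA : ∀ i, b i ∈ A i := fun i ↦ (hb i).1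
  have hbu : ∀ i j, b i ∈ A j → j = i := fun i j hij ↦ by
    by_contra hji
    exact (hb i).2 (mem_iUnion₂.2 ⟨j, hji, hij⟩)
  have key : ∀ F ∈ ℱ, ∀ i, (A i ∩ F).Nonempty → b i ∈ F := fun F hF i hi ↦
    hA.mem_cyclicFlat hM (hℱ hF) hi (hbA i) (hbu i)
  -- Complements are used so that intersections of flats become intersections of complements of the
  -- `S X`, as in inclusion-exclusion, and unions of flats correspond to `𝒢.inf S`.
  set S : Set α → Finset (Fin r) := fun X ↦ Finset.univ.filter fun i ↦ b i ∉ X with hS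
  have hinter : M.intRk (⋂₀ (ℱ : Set (Set α))) = (ℱ.inf fun X ↦ (S X)ᶜ).card := by
    rw [hA.intRk_eq_card hM hbA hbu]
    · congr 2
      ext i
      simp [hS, Finset.mem_inf]
    · rintro i ⟨x, hxi, hx⟩ F hF
      exact key F hF i ⟨x, hxi, hx F hF⟩
  have hunion : ∀ 𝒢 ∈ ℱ.powerset, M.intRk (⋃₀ (𝒢 : Set (Set α))) = r - (𝒢.inf S).card := by
    intro 𝒢 h𝒢
    rw [hA.intRk_eq_card hM hbA hbu]
    · rw [eq_sub_iff_add_eq]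
      have : 𝒢.inf S = (Finset.univ.filter fun i ↦ b i ∈ ⋃₀ (𝒢 : Set (Set α)))ᶜ := by
        ext i
        simp [hS, Finset.mem_inf]
      rw [this, ← Nat.cast_add, Finset.card_add_card_compl, Fintype.card_fin]
    · rintro i ⟨x, hxi, F, hF, hx⟩
      exact ⟨F, hF, key F (Finset.mem_powerset.1 h𝒢 hF) i ⟨x, hxi, hx⟩⟩
  rw [MasonEquality, hinter, Finset.inclusion_exclusion_card_inf_compl]
  -- The constant `r` in each union rank contributes nothing, as the signs over subsets of a
  -- nonempty family sum to zero.
  calc _ = ∑ 𝒢 ∈ ℱ.powerset, (-1 : ℤ) ^ 𝒢.card * (𝒢.inf S).card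
        - (∑ 𝒢 ∈ ℱ.powerset, (-1 : ℤ) ^ 𝒢.card) * r := by
        rw [Finset.sum_powerset_neg_one_pow_card_of_nonempty hne, zero_mul, sub_zero]
    _ = _ := by
        rw [Finset.sum_mul, ← Finset.sum_sub_distrib]
        refine Finset.sum_congr rfl fun 𝒢 h𝒢 ↦ ?_
        rw [hunion 𝒢 h𝒢]
        ring

end Presentation

/-! ### From a base spanning every cyclic flat to a fundamental presentation. -/

section FundamentalBase

variable {α : Type*} {M : Matroid α}

/-- A base meeting every cyclic flat in a basis of it makes the matroid fundamental
transversal: the elements not spanned by `B \ {b}` form the presentation. -/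
lemma IsBase.isFundamentalTransversal (hM : M.E.Finite) {B : Set α} (hB : M.IsBase B)
    (h : ∀ F ∈ M.cyclicFlats, M.IsBasis (B ∩ F) F) : M.IsFundamentalTransversal := by
  have hBfin := hM.subset hB.subset_ground
  have : Fintype B := hBfin.fintype
  let e := (Fintype.equivFin B).symm
  set A : Fin (Fintype.card B) → Set α := fun i ↦ M.E \ M.closure (B \ {(e i : α)}) with hA
  refine ⟨_, A, ⟨fun i ↦ sdiff_subset, fun I ↦ ⟨fun hI ↦ ?_, ?_⟩⟩, fun i ↦ ⟨e i, ?_, ?_⟩⟩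
  -- Hall's condition: `S` is spanned by the set `J` of those `b ∈ B` whose fundamental cocircuit
  -- meets `S`, so `|S| ≤ |J|`.
  · refine exists_transversal_of_forall_subset fun S hS hSfin ↦ ?_
    have hSI := hI.subset hS
    set J : Set α := (fun i ↦ (e i : α)) '' (meetingIndices A S : Set _) with hJ
    have hinj : Function.Injective fun i ↦ (e i : α) :=
      Subtype.val_injective.comp e.injective
    have hJB : J ⊆ B := by rintro _ ⟨i, -, rfl⟩; exact (e i).2
    have hSJ : S ⊆ M.closure J := by
      -- Writing `J` as an intersection of sets `B \ {b}` needs at least one such `b`.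
      obtain hBJ | hBJ := (B \ J).eq_empty_or_nonempty
      · rw [hJB.antisymm (sdiff_eq_empty.1 hBJ), hB.closure_eq]
        exact hSI.subset_ground
      · have hJinter : J = ⋂₀ ((fun b ↦ B \ {b}) '' (B \ J)) := by
          ext x
          simp only [sInter_image, mem_iInter₂, mem_sdiff, mem_singleton_iff]
          refine ⟨fun hx b hb ↦ ⟨hJB hx, fun hxb ↦ hb.2 (hxb ▸ hx)⟩, fun hx ↦ ?_⟩
          obtain ⟨b, hb⟩ := hBJ
          by_contra hxJ
          exact (hx x ⟨(hx b hb).1, hxJ⟩).2 rfl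
        rw [hJinter, hB.indep.closure_sInter_eq_biInter_closure_of_forall_subset
          (hBJ.image _) (by rintro _ ⟨b, -, rfl⟩; exact sdiff_subset)]
        refine subset_iInter₂ fun D hD ↦ ?_
        obtain ⟨b, hb, rfl⟩ := hD
        intro x hx
        by_contra hxb
        refine hb.2 ⟨e.symm ⟨b, hb.1⟩, ?_, by simp⟩
        refine Finset.mem_coe.2 (mem_meetingIndices.2 ⟨x, ⟨hSI.subset_ground hx, ?_⟩, hx⟩)
        simpa using hxb
    have hle := (hSI.encard_le_eRk_of_subset hSJ).trans
      ((M.eRk_closure_eq J).trans_le (M.eRk_le_encard J))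
    have hJcard : J.encard = (meetingIndices A S).card := by
      rw [hJ, hinj.encard_image, encard_coe_eq_coe_finsetCard]
    rw [hJcard, ← hSfin.cast_ncard_eq] at hle
    exact_mod_cast hle
  · rintro ⟨φ, hφ, hφA⟩
    have hIE : I ⊆ M.E := fun x hx ↦ (hφA ⟨x, hx⟩).1
    by_contra hI
    obtain ⟨C, hCI, hC⟩ := (show M.Dep I from ⟨hI, hIE⟩).exists_isCircuit_subset
    have hCcyc : M.IsCyclicSet C := isCyclicSet_iff.2 fun x hx ↦ ⟨C, hC, Subset.rfl, hx⟩
    have hbasis := h _ hCcyc.closure_mem_cyclicFlats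
    have hrk := intRk_eq_ncard_of_isBasis' hbasis.isBasis'
    rw [intRk_closure] at hrk
    have hcard := hC.ncard_eq_intRk_add_one hM
    -- The transversal maps `C` into `B ∩ closure C`: if the base element matched to `x` were
    -- outside `closure C`, then `B` without it would still span `closure C`, hence `x`, contrary to
    -- `x ∈ A (φ x)`. This forces `|C| ≤ r(C)`.
    have hle : C.ncard ≤ (B ∩ M.closure C).ncard := by
      classical
      refine ncard_le_ncard_of_injOn
        (fun x ↦ if hx : x ∈ I then (e (φ ⟨x, hx⟩) : α) else x) ?_ ?_ (hBfin.inter_of_left _)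
      · intro x hx
        simp only [dif_pos (hCI hx)]
        refine ⟨Subtype.coe_prop _, ?_⟩
        by_contra hnot
        refine (hφA ⟨x, hCI hx⟩).2 ?_
        have hx1 : x ∈ M.closure C := M.mem_closure_of_mem hx hC.subset_ground
        exact M.closure_subset_closure (subset_sdiff_singleton inter_subset_left
          fun hmem ↦ hnot hmem.2) (hbasis.subset_closure hx1)
      · intro x hx y hy hxy
        dsimp only at hxy
        rw [dif_pos (hCI hx), dif_pos (hCI hy)] at hxy
        exact congrArg Subtype.val (hφ (e.injective (Subtype.ext hxy)))
    omega
  · exact ⟨hB.subset_ground (e i).2, hB.indep.notMem_closure_sdiff_of_mem (e i).2⟩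
  · simp only [mem_iUnion, not_exists]
    intro j hj hmem
    refine hmem.2 (M.mem_closure_of_mem ⟨(e i).2, fun hij ↦ hj ?_⟩
      (sdiff_subset.trans hB.subset_ground))
    exact (e.injective (Subtype.ext hij)).symm

end FundamentalBase

end Matroid

/-- Möbius inversion from above on a finite family of sets. -/
lemma Finset.exists_forall_eq_sum_superset {α : Type*} [DecidableEq (Set α)]
    [DecidableRel ((· ⊆ ·) : Set α → Set α → Prop)] (s : Finset (Set α)) (f : Set α → ℤ) :
    ∃ μ : Set α → ℤ, ∀ X ∈ s, f X = ∑ Y ∈ s with X ⊆ Y, μ Y := by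
  induction s using Finset.strongInduction with
  | H s ih =>
    obtain rfl | hne := s.eq_empty_or_nonempty
    · simp
    -- A minimal `m` contains no other member, so the weight at `m` enters only the equation for `m`
    -- and can be chosen last.
    obtain ⟨m, hm⟩ := s.exists_minimal hne
    obtain ⟨μ, hμ⟩ := ih _ (Finset.erase_ssubset hm.prop)
    have hs : ∀ X, s.filter (X ⊆ ·) = (insert m (s.erase m)).filter (X ⊆ ·) := fun X ↦ by
      rw [Finset.insert_erase hm.prop]
    have hupd : ∀ c X, ∑ Y ∈ s.erase m with X ⊆ Y, Function.update μ m c Y =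
        ∑ Y ∈ s.erase m with X ⊆ Y, μ Y := fun c X ↦
      Finset.sum_congr rfl fun Y hY ↦
        Function.update_of_ne (Finset.ne_of_mem_erase (Finset.mem_filter.1 hY).1) _ _
    have hnm : ∀ X, m ∉ (s.erase m).filter (X ⊆ ·) := by simp
    refine ⟨Function.update μ m (f m - ∑ Y ∈ s.erase m with m ⊆ Y, μ Y), fun X hX ↦ ?_⟩
    rw [hs, Finset.filter_insert]
    obtain hXm | hXm := eq_or_ne X m
    · rw [hXm, if_pos subset_rfl, Finset.sum_insert (hnm _), hupd, Function.update_self,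
        sub_add_cancel]
    · have hXs : X ∈ s.erase m := Finset.mem_erase.2 ⟨hXm, hX⟩
      rw [if_neg fun h ↦ hXm (hm.eq_of_subset hX h), hupd]
      exact hμ X hXs

namespace Matroid

open Set

/-! ### From the Mason equality on filters to a base spanning every cyclic flat. -/

section FilterEquality

variable {α : Type*} {M : Matroid α}

open scoped Classical in
/-- Weights on cyclic flats that express the ranks in the Mason equality: the weight of `Y`
counts the base elements lying in exactly those cyclic flats that are not below `Y`. -/
lemma exists_weight {𝒵 : Finset (Set α)}
    (h𝒵 : (𝒵 : Set (Set α)) = M.cyclicFlats) :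
    ∃ β : Set α → ℤ, (∀ X ∈ 𝒵, M.intRk X = ∑ Y ∈ 𝒵 with ¬ X ⊆ Y, β Y) ∧
      ∀ ℱ : Finset (Set α), ℱ.Nonempty → ℱ ⊆ 𝒵 → M.MasonEquality ℱ →
        M.intRk (⋂₀ (ℱ : Set (Set α))) = ∑ Y ∈ 𝒵 with ∀ X ∈ ℱ, ¬ X ⊆ Y, β Y := by
  obtain ⟨μ, hμ⟩ := 𝒵.exists_forall_eq_sum_superset M.intRk
  have hunion : ∀ 𝒢 : Finset (Set α), 𝒢 ⊆ 𝒵 →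
      M.intRk (⋃₀ (𝒢 : Set (Set α))) = ∑ Y ∈ 𝒵 with ∀ X ∈ 𝒢, X ⊆ Y, μ Y := by
    intro 𝒢 h𝒢
    -- The closure of the union is a cyclic flat of the same rank, with the same flats above it.
    have hcyc := isCyclicSet_sUnion (h𝒵 ▸ Finset.coe_subset.2 h𝒢)
    have hmem : M.closure (⋃₀ (𝒢 : Set (Set α))) ∈ 𝒵 := by
      rw [← Finset.mem_coe, h𝒵]
      exact hcyc.closure_mem_cyclicFlats
    rw [← intRk_closure, hμ _ hmem]
    refine Finset.sum_congr (Finset.filter_congr fun Y hY ↦ ?_) fun _ _ ↦ rfl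
    have hflat : Y ∈ M.cyclicFlats := h𝒵 ▸ Finset.mem_coe.2 hY
    simp only [← Finset.mem_coe (s := 𝒢), ← sUnion_subset_iff]
    refine ⟨(M.subset_closure _ hcyc.subset_ground).trans, fun hsub ↦ ?_⟩
    exact (M.closure_subset_closure hsub).trans_eq hflat.1.closure
  -- The empty family gives total weight `r(∅) = 0`, so negating `μ` turns sums over supersets into
  -- sums over the complementary flats.
  have htotal : ∑ Y ∈ 𝒵, μ Y = 0 := by
    have := hunion ∅ (by simp)
    simpa using this.symm
  refine ⟨fun Y ↦ - μ Y, fun X hX ↦ ?_, fun ℱ hne hℱ hmason ↦ ?_⟩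
  · have := Finset.sum_filter_add_sum_filter_not 𝒵 (X ⊆ ·) μ
    rw [hμ X hX, Finset.sum_neg_distrib]
    omega
  · rw [MasonEquality] at hmason
    rw [hmason]
    calc _ = ∑ 𝒢 ∈ ℱ.powerset, ∑ Y ∈ 𝒵,
          if ∀ X ∈ 𝒢, X ⊆ Y then (-1 : ℤ) ^ (𝒢.card + 1) * μ Y else 0 := by
          refine Finset.sum_congr rfl fun 𝒢 h𝒢 ↦ ?_
          rw [hunion 𝒢 ((Finset.mem_powerset.1 h𝒢).trans hℱ), Finset.mul_sum,
            Finset.sum_filter]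
      -- For fixed `Y` the inner alternating sum vanishes unless no member of `ℱ` lies below `Y`.
      _ = ∑ Y ∈ 𝒵, ∑ 𝒢 ∈ (ℱ.filter (· ⊆ Y)).powerset, (-1 : ℤ) ^ 𝒢.card * (- μ Y) := by
          rw [Finset.sum_comm]
          refine Finset.sum_congr rfl fun Y hY ↦ ?_
          rw [← Finset.sum_filter]
          refine Finset.sum_congr ?_ fun 𝒢 _ ↦ by ring
          ext 𝒢
          simp only [Finset.mem_filter, Finset.mem_powerset, Finset.subset_iff]
          exact ⟨fun h X hX ↦ ⟨h.1 hX, h.2 X hX⟩,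
            fun h ↦ ⟨fun X hX ↦ (h hX).1, fun X hX ↦ (h hX).2⟩⟩
      _ = _ := by
          rw [Finset.sum_filter]
          refine Finset.sum_congr rfl fun Y hY ↦ ?_
          rw [← Finset.sum_mul, Finset.sum_powerset_neg_one_pow_card]
          by_cases hno : ∀ X ∈ ℱ, ¬ X ⊆ Y
          · rw [if_pos hno, if_pos (Finset.filter_eq_empty_iff.2 hno), one_mul]
          · rw [if_neg hno, if_neg fun h ↦ hno (Finset.filter_eq_empty_iff.1 h), zero_mul]

lemma isFundamentalTransversal_of_forall_filter (hM : M.E.Finite)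
    (h : ∀ ℱ : Finset (Set α), ℱ.Nonempty → (ℱ : Set (Set α)) ⊆ M.cyclicFlats →
      (∀ X ∈ ℱ, ∀ Y ∈ M.cyclicFlats, X ⊆ Y → Y ∈ ℱ) → M.MasonEquality ℱ) :
    M.IsFundamentalTransversal := by
  classical
  obtain ⟨𝒵, h𝒵⟩ := (cyclicFlats_finite hM).exists_finset_coe
  have hmem : ∀ X, X ∈ M.cyclicFlats ↔ X ∈ 𝒵 := fun X ↦ by rw [← h𝒵, Finset.mem_coe]
  obtain ⟨β, hβ, hβF⟩ := exists_weight h𝒵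
  replace hβF : ∀ ℱ : Finset (Set α), ℱ.Nonempty → ℱ ⊆ 𝒵 →
      (∀ X ∈ ℱ, ∀ Y ∈ 𝒵, X ⊆ Y → Y ∈ ℱ) →
      M.intRk (⋂₀ (ℱ : Set (Set α))) = ∑ Y ∈ 𝒵 with ∀ X ∈ ℱ, ¬ X ⊆ Y, β Y :=
    fun ℱ hne hℱ hup ↦ hβF ℱ hne hℱ (h ℱ hne (h𝒵 ▸ Finset.coe_subset.2 hℱ)
      fun X hX Y hY ↦ hup X hX Y ((hmem Y).1 hY))
  set W : Set α → Set α := fun Y ↦ {x | ∀ X ∈ 𝒵, ¬ X ⊆ Y → x ∈ X} with hW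
  -- The side condition excludes only the top cyclic flat: its filter would be empty, and its weight
  -- is minus its rank.
  have hexists : ∀ Y ∈ 𝒵, (∃ X ∈ 𝒵, ¬ X ⊆ Y) →
      ∃ D : Set α, D ⊆ W Y \ Y ∧ D ⊆ M.E ∧ (D.ncard : ℤ) = β Y := by
    rintro Y hY ⟨X₀, hX₀, hX₀Y⟩
    set ℱ := 𝒵.filter (¬ · ⊆ Y) with hℱ
    have hW1 : W Y = ⋂₀ (ℱ : Set (Set α)) := by
      ext x
      simp [hW, hℱ]
    have hW2 : W Y ∩ Y = ⋂₀ ((insert Y ℱ : Finset (Set α)) : Set (Set α)) := by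
      rw [Finset.coe_insert, sInter_insert, hW1, inter_comm]
    have hWE : W Y ⊆ M.E := fun x hx ↦ ((hmem X₀).2 hX₀).1.subset_ground (hx X₀ hX₀ hX₀Y)
    have hr1 := hβF ℱ ⟨X₀, Finset.mem_filter.2 ⟨hX₀, hX₀Y⟩⟩ (Finset.filter_subset _ _)
      fun X hX Z hZ hXZ ↦ Finset.mem_filter.2
        ⟨hZ, fun hZY ↦ (Finset.mem_filter.1 hX).2 (hXZ.trans hZY)⟩
    have hr2 := hβF (insert Y ℱ) (Finset.insert_nonempty _ _)
      (Finset.insert_subset hY (Finset.filter_subset _ _)) fun X hX Z hZ hXZ ↦ by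
        by_cases hZY : Z ⊆ Y
        · obtain rfl | hX := Finset.mem_insert.1 hX
          · exact Finset.mem_insert.2 (.inl (hZY.antisymm hXZ))
          · exact absurd (hXZ.trans hZY) (Finset.mem_filter.1 hX).2
        · exact Finset.mem_insert_of_mem (Finset.mem_filter.2 ⟨hZ, hZY⟩)
    -- A flat `Z` above no member of `ℱ` is not in `ℱ`, so `Z ⊆ Y`. Hence adding `Y` to the filter
    -- removes exactly the term `β Y` from the sum.
    have hsplit : 𝒵.filter (fun Z ↦ ∀ X ∈ ℱ, ¬ X ⊆ Z) =
        insert Y (𝒵.filter fun Z ↦ ∀ X ∈ insert Y ℱ, ¬ X ⊆ Z) := by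
      ext Z
      simp only [Finset.mem_insert, Finset.mem_filter, forall_eq_or_imp]
      constructor
      · rintro ⟨hZ, hZF⟩
        by_cases hYZ : Y ⊆ Z
        · refine .inl (Subset.antisymm ?_ hYZ)
          by_contra hZY
          exact hZF Z (Finset.mem_filter.2 ⟨hZ, hZY⟩) subset_rfl
        · exact .inr ⟨hZ, hYZ, hZF⟩
      · rintro (rfl | ⟨hZ, -, hZF⟩)
        · exact ⟨hY, fun X hX ↦ (Finset.mem_filter.1 hX).2⟩
        · exact ⟨hZ, hZF⟩
    have hnot : Y ∉ 𝒵.filter fun Z ↦ ∀ X ∈ insert Y ℱ, ¬ X ⊆ Z := by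
      simp
    rw [hsplit, Finset.sum_insert hnot, ← hr2, ← hW1, ← hW2] at hr1
    have hmono : 0 ≤ β Y := by
      have hle : M.intRk (W Y ∩ Y) ≤ M.intRk (W Y) := by
        rw [intRk, intRk]
        exact_mod_cast ENat.toNat_le_toNat (M.eRk_mono inter_subset_left)
          (eRk_ne_top_of_ground_finite hM _)
      linarith
    have hcard := intRk_le_intRk_inter_add_ncard_sdiff hM hWE Y
    obtain ⟨D, hD, hDcard⟩ := exists_subset_card_eq (s := W Y \ Y) (n := (β Y).toNat)
      (by omega)
    exact ⟨D, hD, hD.trans (sdiff_subset.trans hWE), by omega⟩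
  choose! D hDsub hDE hDcard using hexists
  set ℬ : Set α → Finset (Set α) := fun X ↦ 𝒵.filter (¬ X ⊆ ·) with hℬ
  have hDX : ∀ X ∈ 𝒵, ∀ Y ∈ ℬ X, D Y ⊆ W Y \ Y ∧ D Y ⊆ M.E ∧ ((D Y).ncard : ℤ) = β Y :=
    fun X hX Y hY ↦
      have hY' := Finset.mem_filter.1 hY
      ⟨hDsub Y hY'.1 ⟨X, hX, hY'.2⟩, hDE Y hY'.1 ⟨X, hX, hY'.2⟩, hDcard Y hY'.1 ⟨X, hX, hY'.2⟩⟩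
  have hsum : ∀ X ∈ 𝒵, M.intRk X = ∑ Y ∈ ℬ X, ((D Y).ncard : ℤ) := fun X hX ↦ by
    rw [hβ X hX]
    exact Finset.sum_congr rfl fun Y hY ↦ (hDX X hX Y hY).2.2.symm
  set B₀ : Set α := {b | ∃ X ∈ 𝒵, ∃ Y ∈ ℬ X, b ∈ D Y} with hB₀
  have hB₀E : B₀ ⊆ M.E := by
    rintro b ⟨X, hX, Y, hY, hb⟩
    exact (hDX X hX Y hY).2.1 hb
  -- A chosen element of `D Y` avoids `Y`, so a circuit `C` is covered by those `D Y` with `Y` not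
  -- above `closure C`. Their sizes total `r(C) = |C| - 1`.
  have hind : M.Indep B₀ := by
    by_contra hdep
    obtain ⟨C, hCB, hC⟩ := (show M.Dep B₀ from ⟨hdep, hB₀E⟩).exists_isCircuit_subset
    have hF : M.closure C ∈ 𝒵 := (hmem _).1 (isCyclicSet_iff.2 fun x hx ↦
      ⟨C, hC, Subset.rfl, hx⟩ : M.IsCyclicSet C).closure_mem_cyclicFlats
    have hcover : C ⊆ ⋃ Y ∈ ℬ (M.closure C), D Y := fun b hb ↦ by
      obtain ⟨X, hX, Y, hY, hbD⟩ := hCB hb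
      refine mem_iUnion₂.2 ⟨Y, Finset.mem_filter.2 ⟨(Finset.mem_filter.1 hY).1, fun hsub ↦ ?_⟩, hbD⟩
      exact ((hDX X hX Y hY).1 hbD).2 (hsub (M.mem_closure_of_mem hb hC.subset_ground))
    have hle := (ncard_le_ncard hcover (hM.subset (iUnion₂_subset fun Y hY ↦
      (hDX _ hF Y hY).2.1))).trans (Finset.set_ncard_biUnion_le _ _)
    have h1 := hsum _ hF
    have h2 := hC.ncard_eq_intRk_add_one hM
    rw [intRk_closure] at h1
    rw [h1] at h2
    have h3 : (C.ncard : ℤ) ≤ ∑ Y ∈ ℬ (M.closure C), ((D Y).ncard : ℤ) := by exact_mod_cast hle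
    omega
  obtain ⟨B, hB, hB₀B⟩ := hind.exists_isBase_superset
  refine hB.isFundamentalTransversal hM fun X hX ↦ ?_
  replace hX := (hmem X).1 hX
  refine (hB.indep.inter_right X).isBasis_of_intRk_le_ncard hM inter_subset_right
    ((hmem X).2 hX).1.subset_ground ?_
  -- An element of `D Y` lies outside `Y` but in every cyclic flat not below `Y`. A common element
  -- of `D Y` and `D Z` thus forces `Y ⊆ Z` and `Z ⊆ Y`.
  have hdisj : ((ℬ X : Finset (Set α)) : Set (Set α)).PairwiseDisjoint D := by
    intro Y hY Z hZ hYZ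
    refine disjoint_left.2 fun b hbY hbZ ↦ hYZ ?_
    have h1 := (hDX X hX Y hY).1 hbY
    have h2 := (hDX X hX Z hZ).1 hbZ
    refine Subset.antisymm ?_ ?_
    · by_contra hsub
      exact h1.2 (h2.1 Y (Finset.mem_filter.1 hY).1 hsub)
    · by_contra hsub
      exact h2.2 (h1.1 Z (Finset.mem_filter.1 hZ).1 hsub)
  have hsub : ⋃ Y ∈ ℬ X, D Y ⊆ B ∩ X := by
    refine iUnion₂_subset fun Y hY b hb ↦ ⟨hB₀B ⟨X, hX, Y, hY, hb⟩, ?_⟩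
    exact ((hDX X hX Y hY).1 hb).1 X hX (Finset.mem_filter.1 hY).2
  rw [hsum X hX, ← Nat.cast_sum]
  have hfin : (B ∩ X).Finite := (hM.subset hB.subset_ground).inter_of_left _
  have hle := ncard_le_ncard hsub hfin
  rw [← finsum_mem_coe_finset, ← (ℬ X).finite_toSet.ncard_biUnion
    (fun Y hY ↦ hM.subset (hDX X hX Y hY).2.1) hdisj]
  exact_mod_cast hle

end FilterEquality

end Matroid

theorem theorem4p1 {α : Type*} (M : Matroid α) (hM : M.E.Finite) :
    List.TFAE [
      M.IsFundamentalTransversal,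
      ∀ ℱ : Finset (Set α), ℱ.Nonempty → (ℱ : Set (Set α)) ⊆ M.cyclicFlats →
        M.MasonEquality ℱ,
      ∀ ℱ : Finset (Set α), ℱ.Nonempty → (ℱ : Set (Set α)) ⊆ M.cyclicFlats →
        IsAntichain (· ⊆ ·) (ℱ : Set (Set α)) → M.MasonEquality ℱ,
      ∀ ℱ : Finset (Set α), ℱ.Nonempty → (ℱ : Set (Set α)) ⊆ M.cyclicFlats →
        (∀ X ∈ ℱ, ∀ Y ∈ M.cyclicFlats, X ⊆ Y → Y ∈ ℱ) → M.MasonEquality ℱ] := by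
  tfae_have 1 → 2 := fun h ℱ hne hℱ ↦ h.masonEquality hM ℱ hne hℱ
  tfae_have 2 → 3 := fun h ℱ hne hℱ _ ↦ h ℱ hne hℱ
  tfae_have 3 → 4 := fun h ℱ hne hℱ _ ↦ Matroid.masonEquality_of_forall_isAntichain h ℱ hne hℱ
  tfae_have 4 → 1 := Matroid.isFundamentalTransversal_of_forall_filter hM
  tfae_finish
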